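/- Let $M$ be a smooth manifold of dimension $n\ge 1$. A Magri–Lenard complex $(M,R_k,X,\theta)$ consists of smooth $(1,1)$-tensor fields $R_1=\mathrm{Id},R_2,\dots,R_n$ on $M$ which commute pairwise as fields of endomorphisms, a smooth vector field $X$ and a smooth $1$-form $\theta$ such that the vector fields $X_k=R_kX$ commute pairwise ($[X_k,X_l]=0$) and all the $1$-forms $\theta_{ij}=\theta R_iR_j$, i.e. $v\mapsto\langle\theta,R_iR_jv\rangle$, are closed. Put $c_{ijk}=\langle\theta,R_iR_jR_kX\rangle$. Let $(M,R_k,X,\theta)$ be a Magri–Lenard complex and let $p\in M$ be a point at which $X_1,\dots,X_n$ are linearly independent. Then the functions $c_{ijk}=\langle\theta_{ij},X_k\rangle$ are symmetric in $i,j,k$, and there are an open neighbourhood $U$ of $p$ and smooth coordinates $x=(x^1,\dots,x^n)$ on $U$ such that: 1. $\partial/\partial x^k=X_k$ on $U$ for all $k$. 2. There are smooth functions $a_{ij}=a_{ji}$ on $U$ with $\theta_{ij}=\mathrm da_{ij}$. 3. For every such family $(a_{ij})$ we have $c_{ijk}=\partial a_{ij}/\partial x^k$ on $U$, and there is a smooth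 function $F(x^1,\dots,x^n)$ on $U$ with $a_{ij}=\dfrac{\partial^2F}{\partial x^i\partial x^j}$. 4. For every such $(a_{ij})$ and every such $F$, with Hessian matrix $h=\left(\dfrac{\partial^2F}{\partial x^i\partial x^j}\right)$: the matrix $\partial h/\partial x^1$ is invertible at a point of $U$ if and only if the $1$-forms $\theta_{11},\dots,\theta_{1n}$ (that is, $\theta R_1,\dots,\theta R_n$) are linearly independent there; and at every such point the WDVV equations hold: $$\frac{\partial h}{\partial x^i}\left(\frac{\partial h}{\partial x^1}\right)^{-1}\frac{\partial h}{\partial x^j}=\frac{\partial h}{\partial x^j}\left(\frac{\partial h}{\partial x^1}\right)^{-1}\frac{\partial h}{\partial x^i},\qquad i,j=1,\dots,n.$$ If moreover $\theta_{11},\dots,\theta_{1n}$ are linearly independent at $p$, then $U$ can be chosen so that they are linearly independent at every point of $U$, so that $\partial h/\partial x^1$ is invertible and the WDVV equations hold on all of $U$. -/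

import Mathlib

open scoped Manifold ContDiff

namespace MagriLenard

noncomputable section

/-! ### Tensor fields on an `n`-dimensional manifold -/

section Manifold

variable {n : ℕ} {M : Type*} [TopologicalSpace M] [ChartedSpace (EuclideanSpace ℝ (Fin n)) M]

/-- Vector fields (not necessarily continuous) on an `n`-dimensional manifold. -/
abbrev VField (n : ℕ) (M : Type*) [TopologicalSpace M]
    [ChartedSpace (EuclideanSpace ℝ (Fin n)) M] : Type _ :=
  (q : M) → TangentSpace (𝓡 n) q

/-- Fields of covectors (not necessarily continuous). -/
abbrev OneForm (n : ℕ) (M : Type*) [TopologicalSpace M]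
    [ChartedSpace (EuclideanSpace ℝ (Fin n)) M] : Type _ :=
  (q : M) → (TangentSpace (𝓡 n) q →L[ℝ] ℝ)

/-- Fields of endomorphisms of the tangent spaces (not necessarily continuous). -/
abbrev Tensor11 (n : ℕ) (M : Type*) [TopologicalSpace M]
    [ChartedSpace (EuclideanSpace ℝ (Fin n)) M] : Type _ :=
  (q : M) → (TangentSpace (𝓡 n) q →L[ℝ] TangentSpace (𝓡 n) q)

variable [IsManifold (𝓡 n) ∞ M]

/-- `X` is a `C^∞` section of the tangent bundle. -/
def SmoothVField (X : VField n M) : Prop :=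
  ContMDiff (𝓡 n) (𝓡 n).tangent ∞ (fun q => (⟨q, X q⟩ : TangentBundle (𝓡 n) M))

/-- `θ` is a `C^∞` section of the cotangent bundle. -/
def SmoothOneForm (θ : OneForm n M) : Prop :=
  ContMDiff (𝓡 n) ((𝓡 n).prod 𝓘(ℝ, EuclideanSpace ℝ (Fin n) →L[ℝ] ℝ)) ∞
    (fun q => Bundle.TotalSpace.mk' (EuclideanSpace ℝ (Fin n) →L[ℝ] ℝ)
      (E := fun q : M => TangentSpace (𝓡 n) q →L[ℝ] Bundle.Trivial M ℝ q) q (θ q))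

/-- `R` is a `C^∞` section of the bundle of endomorphisms of the tangent bundle. -/
def SmoothTensor11 (R : Tensor11 n M) : Prop :=
  ContMDiff (𝓡 n)
    ((𝓡 n).prod 𝓘(ℝ, EuclideanSpace ℝ (Fin n) →L[ℝ] EuclideanSpace ℝ (Fin n))) ∞
    (fun q => Bundle.TotalSpace.mk'
      (EuclideanSpace ℝ (Fin n) →L[ℝ] EuclideanSpace ℝ (Fin n))
      (E := fun q : M => TangentSpace (𝓡 n) q →L[ℝ] TangentSpace (𝓡 n) q) q (R q))

/-- The expression of the covector field `η` in the chart `e`, i.e. its pullback by `e.symm`, a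
`1`-form on the open set `e.target` of `ℝⁿ`. -/
def localForm (η : OneForm n M)
    (e : OpenPartialHomeomorph M (EuclideanSpace ℝ (Fin n))) (y : EuclideanSpace ℝ (Fin n)) :
    EuclideanSpace ℝ (Fin n) →L[ℝ] ℝ :=
  (η (e.symm y)).comp (mfderiv (𝓡 n) (𝓡 n) e.symm y)

/-- A (smooth) `1`-form is closed: its exterior derivative vanishes in every smooth chart. -/
def IsClosedOneForm (η : OneForm n M) : Prop :=
  ∀ e ∈ IsManifold.maximalAtlas (𝓡 n) ∞ M, ∀ y ∈ e.target,
    extDeriv (fun z => ContinuousAlternatingMap.ofSubsingleton ℝ (EuclideanSpace ℝ (Fin n)) ℝ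
      (0 : Fin 1) (localForm η e z)) y = 0

/-- The vector field `R X`. -/
def applyField (R : Tensor11 n M) (X : VField n M) : VField n M :=
  fun q => R q (X q)

/-- The `1`-form `θ R R'`, i.e. `v ↦ ⟨θ, R R' v⟩`. -/
def formComp (θ : OneForm n M) (R R' : Tensor11 n M) : OneForm n M :=
  fun q => (θ q).comp ((R q).comp (R' q))

/-- `(M, R, X, θ)` is a Magri–Lenard complex. The index `1` of the text is `0 : Fin n` here. -/
structure IsMagriLenardComplex [NeZero n] (R : Fin n → Tensor11 n M) (X : VField n M)
    (θ : OneForm n M) : Prop where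
  smooth_R : ∀ k, SmoothTensor11 (R k)
  smooth_X : SmoothVField X
  smooth_θ : SmoothOneForm θ
  R_commute : ∀ k l q, (R k q).comp (R l q) = (R l q).comp (R k q)
  R_one : ∀ q, R 0 q = ContinuousLinearMap.id ℝ (TangentSpace (𝓡 n) q)
  fields_commute : ∀ k l q,
    VectorField.mlieBracket (𝓡 n) (applyField (R k) X) (applyField (R l) X) q = 0
  forms_closed : ∀ k l, IsClosedOneForm (formComp θ (R k) (R l))

/-- The functions `c_ijk = ⟨θ, R_i R_j R_k X⟩`. -/
def cFun (R : Fin n → Tensor11 n M) (X : VField n M) (θ : OneForm n M)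
    (i j k : Fin n) (q : M) : ℝ :=
  θ q (R i q (R j q (R k q (X q))))

/-- The smooth chart `e` gives coordinates `x¹, …, xⁿ` on `e.source` whose coordinate vector fields
`∂/∂xᵏ` (the images under `e.symm` of the constant unit fields) are the fields `Y k`. -/
structure IsCoordinateSystemFor (e : OpenPartialHomeomorph M (EuclideanSpace ℝ (Fin n)))
    (Y : Fin n → VField n M) : Prop where
  mem_atlas : e ∈ IsManifold.maximalAtlas (𝓡 n) ∞ M
  coord_field : ∀ k, ∀ y ∈ e.target,
    mfderiv (𝓡 n) (𝓡 n) e.symm y (EuclideanSpace.single k (1 : ℝ)) = Y k (e.symm y)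

/-- `a` is a symmetric family of smooth potentials on `U` of the `1`-forms `θ R_i R_j`:
`a_ij = a_ji` and `d a_ij = θ R_i R_j` on `U`. -/
structure IsPotentialFamily (R : Fin n → Tensor11 n M) (θ : OneForm n M) (U : Set M)
    (a : Fin n → Fin n → M → ℝ) : Prop where
  smooth : ∀ i j, ContMDiffOn (𝓡 n) 𝓘(ℝ, ℝ) ∞ (a i j) U
  symm : ∀ i j, ∀ q ∈ U, a i j q = a j i q
  deriv_eq : ∀ i j, ∀ q ∈ U,
    HasMFDerivAt (𝓡 n) 𝓘(ℝ, ℝ) (a i j) q (formComp θ (R i) (R j) q)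

end Manifold

/-! ### The WDVV equations -/

section WDVV

variable {n : ℕ}

/-- The partial derivative `∂f/∂xᵏ` of a function on `ℝⁿ`. -/
def partialDeriv (k : Fin n) (f : EuclideanSpace ℝ (Fin n) → ℝ) (y : EuclideanSpace ℝ (Fin n)) :
    ℝ :=
  fderiv ℝ f y (EuclideanSpace.single k 1)

/-- The Hessian matrix `h = (∂²F/∂xⁱ∂xʲ)`. -/
def hessian (F : EuclideanSpace ℝ (Fin n) → ℝ) (y : EuclideanSpace ℝ (Fin n)) :
    Matrix (Fin n) (Fin n) ℝ :=
  Matrix.of fun i j => partialDeriv i (partialDeriv j F) y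

/-- The matrix `∂h/∂xᵏ` of the partial derivatives of the entries of the Hessian `h` of `F`. -/
def hessianDeriv (F : EuclideanSpace ℝ (Fin n) → ℝ) (k : Fin n) (y : EuclideanSpace ℝ (Fin n)) :
    Matrix (Fin n) (Fin n) ℝ :=
  Matrix.of fun i j => partialDeriv k (fun z => hessian F z i j) y

/-- The Hessian `h` of `F` satisfies the WDVV equations at `y`: the matrix `∂h/∂x¹` is invertible
and `∂h/∂xⁱ (∂h/∂x¹)⁻¹ ∂h/∂xʲ = ∂h/∂xʲ (∂h/∂x¹)⁻¹ ∂h/∂xⁱ` for all `i, j`. -/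
def SatisfiesWDVVAt [NeZero n] (F : EuclideanSpace ℝ (Fin n) → ℝ)
    (y : EuclideanSpace ℝ (Fin n)) : Prop :=
  IsUnit (hessianDeriv F 0 y) ∧
    ∀ i j, hessianDeriv F i y * (hessianDeriv F 0 y)⁻¹ * hessianDeriv F j y =
      hessianDeriv F j y * (hessianDeriv F 0 y)⁻¹ * hessianDeriv F i y

/-- `F` is a smooth function on the open set `V` of `ℝⁿ` with `∂²F/∂xⁱ∂xʲ = b_ij` there. -/
def IsHessianPotential (F : EuclideanSpace ℝ (Fin n) → ℝ) (V : Set (EuclideanSpace ℝ (Fin n)))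
    (b : Fin n → Fin n → EuclideanSpace ℝ (Fin n) → ℝ) : Prop :=
  ContDiffOn ℝ ∞ F V ∧ ∀ i j, ∀ y ∈ V, b i j y = hessian F y i j

end WDVV

end

end MagriLenard

open MagriLenard

/-! Coordinates come without flows. Let `A` be the matrix with columns the commuting fields `V k`,
read in a chart. Differentiating `A⁻¹ V k = e_k` shows that the antisymmetric part of the derivative
of `A⁻¹` on the frame is given by the brackets `[V k, V l]`, so the dual coframe is closed
(`fderiv_inverse_frameMap_symm`). On a ball it has a primitive, which the inverse function theorem
turns into a chart with coordinate fields `V k`.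

On a convex coordinate domain the closed forms `θ_ij` have potentials `a_ij`, and `∂a_ij/∂xᵏ =
⟨θ_ij, X_k⟩ = c_ijk`. The `R_k` commute, so `c_ijk` is totally symmetric; two applications of the
Poincaré lemma then make `a_ij` a Hessian.

Thus `∂h/∂xᵏ` is the matrix `C_k = (c_ijk)`. If `A_k` now denotes the matrix of `R_k` in the basis
`X_1, …, X_n`, then `C_k = A_kᵀ C_1`, so `C_i C_1⁻¹ C_j = A_iᵀ A_jᵀ C_1`, and WDVV is the
commutation of the `R_k` (`wdvv_of_commute`). Moreover `C_1` is the matrix of the covectors `θ R_j`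
in that basis, so it is invertible exactly when they are independent. -/

namespace MagriLenard

open Set Filter Topology

/-! ### Poincaré lemma for 1-forms -/

section Calculus

variable {E F : Type*} [NormedAddCommGroup E] [NormedSpace ℝ E] [NormedAddCommGroup F]
  [NormedSpace ℝ F]

/-- A function whose derivative is smooth on an open set is smooth there. -/
theorem contDiffOn_infty_of_hasFDerivAt {f : E → F} {f' : E → E →L[ℝ] F} {s : Set E}
    (hs : IsOpen s) (hf : ∀ y ∈ s, HasFDerivAt f (f' y) y) (hf' : ContDiffOn ℝ ∞ f' s) :
    ContDiffOn ℝ ∞ f s := by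
  rw [contDiffOn_infty_iff_fderiv_of_isOpen hs]
  exact ⟨fun y hy => (hf y hy).differentiableAt.differentiableWithinAt,
    hf'.congr fun y hy => (hf y hy).fderiv⟩

/-- The smooth Poincaré lemma for `1`-forms on convex open sets. -/
theorem exists_smooth_primitive [CompleteSpace F] {η : E → E →L[ℝ] F} {s : Set E}
    (hs : IsOpen s) (hconv : Convex ℝ s) (hη : ContDiffOn ℝ ∞ η s)
    (hsymm : ∀ y ∈ s, ∀ u v, fderiv ℝ η y u v = fderiv ℝ η y v u) :
    ∃ f : E → F, (∀ y ∈ s, HasFDerivAt f (η y) y) ∧ ContDiffOn ℝ ∞ f s := by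
  obtain ⟨f, hf⟩ := hconv.exists_forall_hasFDerivAt_of_fderiv_symmetric hs
    (hη.differentiableOn (by simp)) hsymm
  exact ⟨f, hf, contDiffOn_infty_of_hasFDerivAt hs hf hη⟩

/-- The exterior derivative of a `1`-form vanishes only if its derivative is symmetric. -/
theorem fderiv_symm_of_extDeriv_eq_zero {η : E → E →L[ℝ] F} {y : E}
    (h : extDeriv (fun z => ContinuousAlternatingMap.ofSubsingleton ℝ E F (0 : Fin 1) (η z)) y = 0)
    (u v : E) : fderiv ℝ η y u v = fderiv ℝ η y v u := by
  have h1 := congrArg (fun a => a ![u, v]) h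
  -- Viewing a covector as an alternating 1-form is linear, so it commutes with differentiation.
  have h2 : fderiv ℝ (fun z => ContinuousAlternatingMap.ofSubsingleton ℝ E F (0 : Fin 1) (η z)) y =
      ((ContinuousAlternatingMap.ofSubsingletonLIE (𝕜 := ℝ) (E := E) (F := F) (0 : Fin 1) :
        (E →L[ℝ] F) →L[ℝ] _)).comp (fderiv ℝ η y) :=
    (ContinuousAlternatingMap.ofSubsingletonLIE (𝕜 := ℝ) (E := E) (F := F) (0 : Fin 1)).comp_fderiv
  simp only [extDeriv, h2, ContinuousAlternatingMap.alternatizeUncurryFin_apply] at h1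
  simpa [Fin.sum_univ_two, Fin.removeNth, sub_eq_zero, ← sub_eq_add_neg] using h1

end Calculus

/-! ### Commuting frames on open sets of `ℝⁿ` -/

section Euclidean

variable {n : ℕ}

local notation "𝔼" => EuclideanSpace ℝ (Fin n)

/-- Continuous linear maps on `ℝⁿ` agree if they agree on the standard basis. -/
theorem clm_ext_single {F : Type*} [NormedAddCommGroup F] [NormedSpace ℝ F] {f g : 𝔼 →L[ℝ] F}
    (h : ∀ k, f (EuclideanSpace.single k 1) = g (EuclideanSpace.single k 1)) : f = g := by
  apply ContinuousLinearMap.coe_injective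
  apply (EuclideanSpace.basisFun (Fin n) ℝ).toBasis.ext
  intro k
  simpa using h k

/-- A bilinear map on `ℝⁿ` is symmetric if it is so on the standard basis. -/
theorem clm_symm_of_single {F : Type*} [NormedAddCommGroup F] [NormedSpace ℝ F]
    {f : 𝔼 →L[ℝ] 𝔼 →L[ℝ] F}
    (h : ∀ k l, f (EuclideanSpace.single k 1) (EuclideanSpace.single l 1) =
      f (EuclideanSpace.single l 1) (EuclideanSpace.single k 1)) (u v : 𝔼) :
    f u v = f v u := by
  have : f = f.flip := clm_ext_single fun k => clm_ext_single fun l => by simpa using h k l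
  conv_lhs => rw [this]
  rfl

/-- The linear map sending the standard basis of `ℝⁿ` to the vectors `v k`. -/
noncomputable def frameMap {F : Type*} [NormedAddCommGroup F] [NormedSpace ℝ F] (v : Fin n → F) :
    𝔼 →L[ℝ] F :=
  ∑ k, (EuclideanSpace.proj k : 𝔼 →L[ℝ] ℝ).smulRight (v k)

@[simp]
theorem frameMap_single {F : Type*} [NormedAddCommGroup F] [NormedSpace ℝ F] (v : Fin n → F)
    (k : Fin n) : frameMap v (EuclideanSpace.single k 1) = v k := by
  simp [frameMap, PiLp.single_apply]

theorem isInvertible_frameMap {v : Fin n → 𝔼} (hv : LinearIndependent ℝ v) :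
    (frameMap v).IsInvertible := by
  have hinj : Function.Injective (frameMap v) := by
    rw [injective_iff_map_eq_zero]
    intro x hx
    have h := Fintype.linearIndependent_iff.1 hv (fun k => x k) (by simpa [frameMap] using hx)
    ext k
    simpa using h k
  exact ⟨(LinearEquiv.ofInjectiveEndo (frameMap v : 𝔼 →ₗ[ℝ] 𝔼) hinj).toContinuousLinearEquiv,
    by ext; simp⟩

/-- A smooth function with values in covectors is one with smooth components. -/
theorem contDiffOn_clm_of_single {F : Type*} [NormedAddCommGroup F] [NormedSpace ℝ F]
    {f : 𝔼 → 𝔼 →L[ℝ] F} {s : Set 𝔼}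
    (h : ∀ k, ContDiffOn ℝ ∞ (fun y => f y (EuclideanSpace.single k 1)) s) :
    ContDiffOn ℝ ∞ f s := by
  have : f = fun y => ∑ k, (EuclideanSpace.proj k : 𝔼 →L[ℝ] ℝ).smulRight
      (f y (EuclideanSpace.single k 1)) := by
    funext y
    exact clm_ext_single fun k => by simp [PiLp.single_apply]
  rw [this]
  refine ContDiffOn.sum fun k _ => ?_
  exact ((ContinuousLinearMap.smulRightL ℝ 𝔼 F (EuclideanSpace.proj k)).contDiff).comp_contDiffOn
    (h k)

/-- The coframe dual to a commuting frame on an open set of `ℝⁿ` is closed. -/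
theorem fderiv_inverse_frameMap_symm {V : Fin n → 𝔼 → 𝔼} {y : 𝔼}
    (hV : ∀ k, DifferentiableAt ℝ (V k) y)
    (hinv : (frameMap fun k => V k y).IsInvertible)
    (hcomm : ∀ k l, VectorField.lieBracket ℝ (V k) (V l) y = 0) (u v : 𝔼) :
    fderiv ℝ (fun z => (frameMap fun k => V k z).inverse) y u v =
      fderiv ℝ (fun z => (frameMap fun k => V k z).inverse) y v u := by
  set A : 𝔼 → 𝔼 →L[ℝ] 𝔼 := fun z => frameMap fun k => V k z with hA
  set B : 𝔼 → 𝔼 →L[ℝ] 𝔼 := fun z => (A z).inverse with hB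
  have hAd : DifferentiableAt ℝ A y := by
    refine DifferentiableAt.fun_sum fun k _ => ?_
    exact ((ContinuousLinearMap.smulRightL ℝ 𝔼 𝔼 (EuclideanSpace.proj k)).differentiableAt).comp y
      (hV k)
  have hBd : DifferentiableAt ℝ B y :=
    DifferentiableAt.comp y (g := ContinuousLinearMap.inverse)
      ((hinv.contDiffAt_map_inverse (n := 1)).differentiableAt (by simp)) hAd
  have hev : ∀ᶠ z in 𝓝 y, (A z).IsInvertible :=
    hAd.continuousAt.eventually_mem (ContinuousLinearEquiv.isOpen.mem_nhds hinv)
  have hconst : ∀ k, (fun z => B z (V k z)) =ᶠ[𝓝 y] fun _ => EuclideanSpace.single k 1 := by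
    intro k
    filter_upwards [hev] with z hz
    have := frameMap_single (fun k => V k z) k
    rw [← this]
    exact hz.inverse_apply_eq.2 rfl
  -- Product rule applied to the locally constant function `B (V k)`.
  have hder : ∀ (k : Fin n) (u : 𝔼), fderiv ℝ B y u (V k y) = - B y (fderiv ℝ (V k) y u) := by
    intro k u
    have h1 := (hconst k).fderiv_eq (𝕜 := ℝ)
    rw [fderiv_clm_apply hBd (hV k), fderiv_const_apply] at h1
    have h2 := congrArg (fun L : 𝔼 →L[ℝ] 𝔼 => L u) h1
    simp at h2
    rw [eq_neg_iff_add_eq_zero, add_comm]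
    exact h2
  have hsymm : ∀ k l : Fin n, fderiv ℝ B y (V l y) (V k y) = fderiv ℝ B y (V k y) (V l y) := by
    intro k l
    rw [hder, hder]
    have := hcomm k l
    rw [VectorField.lieBracket_eq, sub_eq_zero] at this
    rw [this]
  -- Symmetry is known on the frame `V k y = A y e_k`, so the form is pulled back by `A y` to the
  -- standard basis and then evaluated at `B y u`, `B y v`.
  have key := clm_symm_of_single (f := ((ContinuousLinearMap.compL ℝ 𝔼 𝔼 𝔼).flip (A y)).comp
    ((fderiv ℝ B y).comp (A y))) (fun k l => by simpa [hA] using hsymm l k)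
    (B y u) (B y v)
  have hAB : ∀ w, A y (B y w) = w := fun w => (hinv.inverse_apply_eq.1 rfl).symm
  simpa [hAB] using key

/-- A commuting frame on an open set of `ℝⁿ` is, locally, the frame of coordinate fields of a
smooth coordinate system. -/
theorem exists_coordinates_of_commuting_frame {V : Fin n → 𝔼 → 𝔼} {s : Set 𝔼} {y₀ : 𝔼}
    (hs : IsOpen s) (hy₀ : y₀ ∈ s) (hV : ∀ k, ContDiffOn ℝ ∞ (V k) s)
    (hli : LinearIndependent ℝ fun k => V k y₀)
    (hcomm : ∀ k l, ∀ y ∈ s, VectorField.lieBracket ℝ (V k) (V l) y = 0) :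
    ∃ Φ : OpenPartialHomeomorph 𝔼 𝔼, y₀ ∈ Φ.source ∧ Φ.source ⊆ s ∧
      ContDiffOn ℝ ∞ Φ Φ.source ∧ ContDiffOn ℝ ∞ Φ.symm Φ.target ∧
      ∀ y ∈ Φ.target, ∀ k, fderiv ℝ Φ.symm y (EuclideanSpace.single k 1) = V k (Φ.symm y) := by
  set A : 𝔼 → 𝔼 →L[ℝ] 𝔼 := fun z => frameMap fun k => V k z with hA
  have hAc : ContDiffOn ℝ ∞ A s := contDiffOn_clm_of_single fun k => by simpa [hA] using hV k
  have hmem : s ∩ A ⁻¹' range ((↑) : (𝔼 ≃L[ℝ] 𝔼) → 𝔼 →L[ℝ] 𝔼) ∈ 𝓝 y₀ :=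
    (hAc.continuousOn.isOpen_inter_preimage hs ContinuousLinearEquiv.isOpen).mem_nhds
      ⟨hy₀, isInvertible_frameMap hli⟩
  -- Invertibility is an open condition; a ball is taken because the Poincaré lemma needs convexity.
  obtain ⟨r, hr, hball⟩ := Metric.mem_nhds_iff.1 hmem
  have hinv : ∀ y ∈ Metric.ball y₀ r, (A y).IsInvertible := fun y hy => (hball hy).2
  have hsub : Metric.ball y₀ r ⊆ s := fun y hy => (hball hy).1
  have hBc : ContDiffOn ℝ ∞ (fun y => (A y).inverse) (Metric.ball y₀ r) := fun y hy =>
    ((hinv y hy).contDiffAt_map_inverse.comp_contDiffWithinAt y (hAc y (hsub hy))).mono hsub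
  obtain ⟨f, hf, hfc⟩ := exists_smooth_primitive Metric.isOpen_ball (convex_ball y₀ r) hBc
    (fun y hy => fderiv_inverse_frameMap_symm
      (fun k => ((hV k).contDiffAt (hs.mem_nhds (hsub hy))).differentiableAt (by simp))
      (hinv y hy) (fun k l => hcomm k l y (hsub hy)))
  have hr₀ := Metric.mem_ball_self (x := y₀) hr
  have hequiv : ∀ y ∈ Metric.ball y₀ r, ∃ L : 𝔼 ≃L[ℝ] 𝔼, (L : 𝔼 →L[ℝ] 𝔼) = (A y).inverse ∧
      ∀ k, L.symm (EuclideanSpace.single k 1) = V k y := by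
    intro y hy
    obtain ⟨L, hL⟩ := hinv y hy
    refine ⟨L.symm, ?_, fun k => ?_⟩
    · rw [← hL, ContinuousLinearMap.inverse_equiv]
    · have := frameMap_single (fun k => V k y) k
      rw [← this, L.symm_symm, ← ContinuousLinearEquiv.coe_coe, hL]
  obtain ⟨L₀, hL₀, -⟩ := hequiv y₀ hr₀
  have hfat : ContDiffAt ℝ ∞ f y₀ := hfc.contDiffAt (Metric.isOpen_ball.mem_nhds hr₀)
  have hf₀ : HasFDerivAt f (L₀ : 𝔼 →L[ℝ] 𝔼) y₀ := hL₀ ▸ hf y₀ hr₀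
  let Ψ := hfat.toOpenPartialHomeomorph f hf₀ (by simp)
  -- The source of `Ψ` is not known to lie in the ball; after restriction the derivative is `A⁻¹` on
  -- the whole source, so that of the inverse map is `A`.
  let Φ := Ψ.restrOpen (Metric.ball y₀ r) Metric.isOpen_ball
  have hΦs : Φ.source ⊆ Metric.ball y₀ r := fun y hy => hy.2
  have hΦt : ∀ y ∈ Φ.target, Φ.symm y ∈ Metric.ball y₀ r := fun y hy => hΦs (Φ.map_target hy)
  have hΦf : ∀ y, Φ y = f y := fun y => rfl
  refine ⟨Φ, ⟨hfat.mem_toOpenPartialHomeomorph_source hf₀ (by simp), hr₀⟩,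
    hΦs.trans hsub, hfc.mono hΦs, fun y hy => ?_, fun y hy k => ?_⟩
  · obtain ⟨L, hL, -⟩ := hequiv _ (hΦt y hy)
    exact (Φ.contDiffAt_symm (f₀' := L) hy (hL ▸ hf _ (hΦt y hy))
      (hfc.contDiffAt (Metric.isOpen_ball.mem_nhds (hΦt y hy)))).contDiffWithinAt
  · obtain ⟨L, hL, hLk⟩ := hequiv _ (hΦt y hy)
    have : HasFDerivAt Φ.symm (L.symm : 𝔼 →L[ℝ] 𝔼) y :=
      Φ.hasFDerivAt_symm hy (hL ▸ hf _ (hΦt y hy))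
    rw [this.fderiv]
    exact hLk k

end Euclidean

/-! ### Pointwise algebra behind WDVV -/

section LinearAlgebra

variable {n : ℕ} {T : Type*} [AddCommGroup T] [Module ℝ T] [TopologicalSpace T]

/-- The matrix of `n` covectors in a basis is invertible iff the covectors are independent. -/
theorem isUnit_matrix_covectors_iff (b : Module.Basis (Fin n) ℝ T) (f : Fin n → T →L[ℝ] ℝ) :
    IsUnit (Matrix.of fun i j => f j (b i)) ↔ LinearIndependent ℝ f := by
  rw [← Matrix.linearIndependent_cols_iff_isUnit]
  -- Evaluation on the basis embeds covectors into `ℝⁿ` and sends `f j` to the `j`-th column.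
  let Φ : (T →L[ℝ] ℝ) →ₗ[ℝ] (Fin n → ℝ) :=
    { toFun := fun g i => g (b i)
      map_add' := fun _ _ => rfl
      map_smul' := fun _ _ => rfl }
  have hΦ : LinearMap.ker Φ = ⊥ := by
    rw [LinearMap.ker_eq_bot]
    intro g g' h
    apply ContinuousLinearMap.coe_injective
    exact b.ext fun i => congrFun h i
  exact Φ.linearIndependent_iff hΦ

/-- The matrices `⟨θ, R_i R_j R_k x⟩` of commuting endomorphisms satisfy the WDVV relations if the
vectors `R_k x` form a basis. -/
theorem wdvv_of_commute (θ : T →L[ℝ] ℝ) (R : Fin n → T →L[ℝ] T) (x : T)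
    (hcomm : ∀ k l, (R k).comp (R l) = (R l).comp (R k)) (b : Module.Basis (Fin n) ℝ T)
    (hb : ∀ k, b k = R k x) {C₀ : Matrix (Fin n) (Fin n) ℝ}
    (hC₀ : C₀ = Matrix.of fun i j => θ (R i (R j x))) (hu : IsUnit C₀)
    {C : Fin n → Matrix (Fin n) (Fin n) ℝ}
    (hC : ∀ k, C k = Matrix.of fun i j => θ (R i (R j (R k x)))) (i j : Fin n) :
    C i * C₀⁻¹ * C j = C j * C₀⁻¹ * C i := by
  have hc : ∀ k l v, R k (R l v) = R l (R k v) := fun k l v => DFunLike.congr_fun (hcomm k l) v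
  let A : Fin n → Matrix (Fin n) (Fin n) ℝ := fun k => LinearMap.toMatrix b b (R k)
  have hA : ∀ k l, A k * A l = A l * A k := by
    intro k l
    simp only [A, ← LinearMap.toMatrix_comp b b b]
    congr 1
    ext v
    exact hc k l v
  -- Expand `R k (b i)` in the basis, after using commutation to move `R i` next to `x`.
  have hCA : ∀ k, C k = (A k).transpose * C₀ := by
    intro k
    ext i j
    have h1 := b.sum_repr (R k (b i))
    rw [hC, hC₀, Matrix.mul_apply]
    simp only [Matrix.of_apply, Matrix.transpose_apply, A, LinearMap.toMatrix_apply,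
      ContinuousLinearMap.coe_coe]
    calc θ (R i (R j (R k x))) = θ (R j (R k (b i))) := by
          rw [hb, hc i j, hc i k]
      _ = θ (R j (∑ m, b.repr (R k (b i)) m • b m)) := by rw [h1]
      _ = _ := by
        simp only [map_sum, map_smul, smul_eq_mul]
        exact Finset.sum_congr rfl fun m _ => by rw [hb m, hc j m]
  have hdet := (Matrix.isUnit_iff_isUnit_det _).1 hu
  rw [hCA i, hCA j, Matrix.mul_assoc, Matrix.mul_assoc, Matrix.mul_assoc, Matrix.mul_assoc,
    ← Matrix.mul_assoc C₀⁻¹, ← Matrix.mul_assoc C₀⁻¹]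
  simp only [← Matrix.mul_assoc]
  rw [Matrix.mul_nonsing_inv_cancel_right _ _ hdet, Matrix.mul_nonsing_inv_cancel_right _ _ hdet,
    ← Matrix.transpose_mul, ← Matrix.transpose_mul, hA]

end LinearAlgebra

/-! ### Coordinate systems and forms on the manifold -/

section Manifold

variable {n : ℕ} {M : Type*} [TopologicalSpace M] [ChartedSpace (EuclideanSpace ℝ (Fin n)) M]

theorem SmoothVField.applyField [IsManifold (𝓡 n) ∞ M] {X : VField n M} (hX : SmoothVField X) {R : Tensor11 n M}
    (hR : SmoothTensor11 R) : SmoothVField (applyField R X) :=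
  ContMDiff.clm_bundle_apply (E₁ := fun q : M => TangentSpace (𝓡 n) q)
    (E₂ := fun q : M => TangentSpace (𝓡 n) q) (b := fun q : M => q) hR hX

theorem SmoothOneForm.apply [IsManifold (𝓡 n) ∞ M] {θ : OneForm n M} (hθ : SmoothOneForm θ) {X : VField n M}
    (hX : SmoothVField X) : ContMDiff (𝓡 n) 𝓘(ℝ, ℝ) ∞ fun q => θ q (X q) := by
  have h := ContMDiff.clm_bundle_apply (E₁ := fun q : M => TangentSpace (𝓡 n) q)
    (E₂ := Bundle.Trivial M ℝ) (b := fun q : M => q) hθ hX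
  intro q
  exact (Bundle.contMDiffAt_section (E := Bundle.Trivial M ℝ) (F := ℝ) q).1 (h q)

variable {e : OpenPartialHomeomorph M (EuclideanSpace ℝ (Fin n))}

theorem mdifferentiable_of_mem_maximalAtlas (he : e ∈ IsManifold.maximalAtlas (𝓡 n) ∞ M) :
    e.MDifferentiable (𝓡 n) (𝓡 n) :=
  ⟨(contMDiffOn_of_mem_maximalAtlas he).mdifferentiableOn (by simp),
    (contMDiffOn_symm_of_mem_maximalAtlas he).mdifferentiableOn (by simp)⟩

/-- A function on the domain of a chart whose expression has the differential `localForm η e`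
has the differential `η`. -/
theorem hasMFDerivAt_of_localForm (he : e ∈ IsManifold.maximalAtlas (𝓡 n) ∞ M) {η : OneForm n M}
    {f : EuclideanSpace ℝ (Fin n) → ℝ} {q : M} (hq : q ∈ e.source)
    (hf : HasFDerivAt f (localForm η e (e q)) (e q)) :
    HasMFDerivAt (𝓡 n) 𝓘(ℝ, ℝ) (fun z => f (e z)) q (η q) := by
  have hd := mdifferentiable_of_mem_maximalAtlas he
  have h := hf.hasMFDerivAt.comp q (hd.mdifferentiableAt hq).hasMFDerivAt
  -- The equality `e.symm (e q) = q` is only propositional, so covectors at the two points are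
  -- compared on the common model space.
  have aux : ∀ q', q' = q → ∀ v : EuclideanSpace ℝ (Fin n), η q' v = η q v := by
    rintro _ rfl v
    rfl
  refine h.congr_mfderiv ?_
  ext v
  have h2 := DFunLike.congr_fun (hd.symm_comp_deriv hq) v
  exact (congrArg (η (e.symm (e q))) h2).trans (aux _ (e.left_inv hq) v)

/-- The expression in a chart of a function with differential `η`. -/
theorem hasFDerivAt_of_hasMFDerivAt (he : e ∈ IsManifold.maximalAtlas (𝓡 n) ∞ M)
    {η : OneForm n M} {a : M → ℝ} {y : EuclideanSpace ℝ (Fin n)} (hy : y ∈ e.target)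
    (ha : HasMFDerivAt (𝓡 n) 𝓘(ℝ, ℝ) a (e.symm y) (η (e.symm y))) :
    HasFDerivAt (fun z => a (e.symm z)) (localForm η e y) y := by
  have hd := mdifferentiable_of_mem_maximalAtlas he
  have h := ha.comp y (hd.mdifferentiableAt_symm hy).hasMFDerivAt
  exact h.hasFDerivAt

variable {Y : Fin n → VField n M} {η : OneForm n M}

theorem IsCoordinateSystemFor.localForm_single (h : IsCoordinateSystemFor e Y)
    {y : EuclideanSpace ℝ (Fin n)} (hy : y ∈ e.target) (k : Fin n) :
    localForm η e y (EuclideanSpace.single k 1) = η (e.symm y) (Y k (e.symm y)) :=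
  congrArg (η (e.symm y)) (h.coord_field k y hy)

/-- A `1`-form with smooth components along the coordinate fields is smooth in the coordinates. -/
theorem IsCoordinateSystemFor.contDiffOn_localForm (h : IsCoordinateSystemFor e Y)
    (hη : ∀ k, ContMDiff (𝓡 n) 𝓘(ℝ, ℝ) ∞ fun q => η q (Y k q)) :
    ContDiffOn ℝ ∞ (localForm η e) e.target := by
  refine contDiffOn_clm_of_single fun k => ?_
  have h1 := (hη k).comp_contMDiffOn (contMDiffOn_symm_of_mem_maximalAtlas h.mem_atlas)
  exact h1.contDiffOn.congr fun y hy => h.localForm_single hy k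

/-- Coordinate fields are independent. -/
theorem IsCoordinateSystemFor.linearIndependent (h : IsCoordinateSystemFor e Y)
    {y : EuclideanSpace ℝ (Fin n)} (hy : y ∈ e.target) :
    LinearIndependent ℝ fun k => Y k (e.symm y) := by
  have hd := mdifferentiable_of_mem_maximalAtlas h.mem_atlas
  have h1 : LinearIndependent ℝ fun k : Fin n =>
      (EuclideanSpace.single k 1 : EuclideanSpace ℝ (Fin n)) :=
    EuclideanSpace.orthonormal_single.linearIndependent
  have hinj : Function.Injective (mfderiv (𝓡 n) (𝓡 n) e.symm y) := hd.symm.mfderiv_injective hy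
  have h2 := h1.map' (mfderiv (𝓡 n) (𝓡 n) e.symm y).toLinearMap (LinearMap.ker_eq_bot.2 hinj)
  have h3 : (fun k => Y k (e.symm y)) = (mfderiv (𝓡 n) (𝓡 n) e.symm y).toLinearMap ∘
      fun k : Fin n => (EuclideanSpace.single k 1 : EuclideanSpace ℝ (Fin n)) :=
    funext fun k => (h.coord_field k y hy).symm
  rw [h3]
  exact h2

/-- The coordinate fields form a basis of each tangent space. -/
theorem IsCoordinateSystemFor.exists_basis (h : IsCoordinateSystemFor e Y)
    {y : EuclideanSpace ℝ (Fin n)} (hy : y ∈ e.target) :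
    ∃ b : Module.Basis (Fin n) ℝ (TangentSpace (𝓡 n) (e.symm y)),
      ∀ k, b k = Y k (e.symm y) := by
  -- The basis constructor needs a nonempty index type, and `n = 0` is not excluded here.
  rcases Nat.eq_zero_or_pos n with rfl | hn
  · have : Subsingleton (TangentSpace (𝓡 0) (e.symm y)) :=
      inferInstanceAs (Subsingleton (EuclideanSpace ℝ (Fin 0)))
    exact ⟨Module.Basis.empty _, fun k => k.elim0⟩
  · have : Nonempty (Fin n) := ⟨⟨0, hn⟩⟩
    have hcard : Fintype.card (Fin n) = Module.finrank ℝ (TangentSpace (𝓡 n) (e.symm y)) :=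
      (finrank_euclideanSpace (𝕜 := ℝ) (ι := Fin n)).symm
    exact ⟨basisOfLinearIndependentOfCardEqFinrank (h.linearIndependent hy) hcard,
      fun k => by simp⟩

/-- A closed `1`-form on a convex coordinate domain is exact. -/
theorem IsCoordinateSystemFor.exists_potential (h : IsCoordinateSystemFor e Y)
    (hconv : Convex ℝ e.target)
    (hη : ∀ k, ContMDiff (𝓡 n) 𝓘(ℝ, ℝ) ∞ fun q => η q (Y k q)) (hclosed : IsClosedOneForm η) :
    ∃ f : M → ℝ, ContMDiffOn (𝓡 n) 𝓘(ℝ, ℝ) ∞ f e.source ∧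
      ∀ q ∈ e.source, HasMFDerivAt (𝓡 n) 𝓘(ℝ, ℝ) f q (η q) := by
  obtain ⟨f, hf, hfc⟩ := exists_smooth_primitive e.open_target hconv
    (h.contDiffOn_localForm hη)
    (fun y hy => fderiv_symm_of_extDeriv_eq_zero (hclosed e h.mem_atlas y hy))
  refine ⟨fun q => f (e q), ?_, fun q hq =>
    hasMFDerivAt_of_localForm h.mem_atlas hq (hf _ (e.map_source hq))⟩
  exact hfc.contMDiffOn.comp (contMDiffOn_of_mem_maximalAtlas h.mem_atlas)
    fun q hq => e.map_source hq

variable [IsManifold (𝓡 n) ∞ M]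

/-- Coordinate systems can be shrunk to arbitrarily small convex ones. -/
theorem IsCoordinateSystemFor.exists_convex_restriction (h : IsCoordinateSystemFor e Y) {p : M}
    (hp : p ∈ e.source) {W : Set M} (hW : W ∈ 𝓝 p) :
    ∃ e' : OpenPartialHomeomorph M (EuclideanSpace ℝ (Fin n)), p ∈ e'.source ∧
      IsCoordinateSystemFor e' Y ∧ e'.source ⊆ W ∧ Convex ℝ e'.target := by
  have hcont : e.symm ⁻¹' W ∈ 𝓝 (e p) :=
    (e.continuousAt_symm (e.map_source hp)).preimage_mem_nhds (by rwa [e.left_inv hp])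
  obtain ⟨r, hr, hball⟩ := Metric.mem_nhds_iff.1
    (inter_mem (e.open_target.mem_nhds (e.map_source hp)) hcont)
  -- Restricting on the target side makes the target exactly a ball.
  let e' := (e.symm.restrOpen (Metric.ball (e p) r) Metric.isOpen_ball).symm
  have htarget : e'.target = Metric.ball (e p) r :=
    inter_eq_right.2 fun y hy => (hball hy).1
  have hsub : e'.target ⊆ e.target := inter_subset_left
  have hsource : e'.source ⊆ e.source := fun q hq => by
    have := e.map_target (hsub (e'.map_source hq))
    have h2 : e.symm (e' q) = q := e'.left_inv hq
    rwa [h2] at this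
  refine ⟨e', ?_, ⟨?_, fun k y hy => h.coord_field k y (hsub hy)⟩, fun q hq => ?_, ?_⟩
  · have h1 : e p ∈ e'.target := htarget ▸ Metric.mem_ball_self hr
    have h2 : e.symm (e p) ∈ e'.source := e'.map_target h1
    rwa [e.left_inv hp] at h2
  · exact e'.mem_maximalAtlas_of_contMDiffOn
      ((contMDiffOn_of_mem_maximalAtlas h.mem_atlas).mono hsource)
      ((contMDiffOn_symm_of_mem_maximalAtlas h.mem_atlas).mono hsub)
  · have h1 : e' q ∈ Metric.ball (e p) r := htarget ▸ e'.map_source hq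
    have h2 : e.symm (e' q) = q := e'.left_inv hq
    have h3 : e.symm (e' q) ∈ W := (hball h1).2
    rwa [h2] at h3
  · rw [htarget]
    exact convex_ball _ _

/-- Commuting fields which are independent at a point are coordinate fields near it. -/
theorem exists_isCoordinateSystemFor (hY : ∀ k, SmoothVField (Y k))
    (hcomm : ∀ k l q, VectorField.mlieBracket (𝓡 n) (Y k) (Y l) q = 0) {p : M}
    (hp : LinearIndependent ℝ fun k => Y k p) :
    ∃ e : OpenPartialHomeomorph M (EuclideanSpace ℝ (Fin n)), p ∈ e.source ∧
      IsCoordinateSystemFor e Y := by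
  set c := chartAt (EuclideanSpace ℝ (Fin n)) p with hc
  have hcm : c ∈ IsManifold.maximalAtlas (𝓡 n) ∞ M := IsManifold.chart_mem_maximalAtlas p
  have hcd := mdifferentiable_of_mem_maximalAtlas hcm
  have hpc : p ∈ c.source := mem_chart_source _ p
  have : IsManifold (𝓡 n) (∞ + 1) M := inferInstanceAs (IsManifold (𝓡 n) ∞ M)
  have h2 : minSmoothness ℝ 2 ≤ ∞ := by
    rw [minSmoothness_of_isRCLikeNormedField]
    exact WithTop.coe_le_coe.2 (le_top : (2 : ℕ∞) ≤ ⊤)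
  have : IsManifold (𝓡 n) (minSmoothness ℝ 2) M := .of_le h2
  -- The frame is read in a chart; pullback by a local diffeomorphism preserves brackets and
  -- independence.
  let V : Fin n → EuclideanSpace ℝ (Fin n) → EuclideanSpace ℝ (Fin n) := fun k =>
    VectorField.mpullback (𝓡 n) (𝓡 n) c.symm (Y k)
  have hinv : ∀ y ∈ c.target, (mfderiv (𝓡 n) (𝓡 n) c.symm y).IsInvertible := fun y hy =>
    ⟨hcd.symm.mfderiv hy, rfl⟩
  have hVeq : ∀ y ∈ c.target, ∀ k, mfderiv (𝓡 n) (𝓡 n) c.symm y (V k y) = Y k (c.symm y) := by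
    intro y hy k
    exact ((hinv y hy).inverse_apply_eq.1 rfl).symm
  have hsymm : ∀ y ∈ c.target, ContMDiffAt (𝓡 n) (𝓡 n) ∞ c.symm y := fun y hy =>
    contMDiffAt_symm_of_mem_maximalAtlas hcm hy
  have hV : ∀ k, ContDiffOn ℝ ∞ (V k) c.target := by
    intro k y hy
    have h1 := ContMDiffAt.mpullback_vectorField_preimage (m := ∞) (hY k (c.symm y))
      (hsymm y hy) (hinv y hy) (by simp)
    have h2 := contMDiffAt_vectorSpace_iff_contDiffAt.1 h1
    exact h2.contDiffWithinAt
  have hVli : LinearIndependent ℝ fun k => V k (c p) := by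
    have hy := c.map_source hpc
    have aux : ∀ q, q = p → LinearIndependent ℝ fun k => Y k q := by
      rintro _ rfl
      exact hp
    have h1 := aux _ (c.left_inv hpc)
    refine LinearIndependent.of_comp (mfderiv (𝓡 n) (𝓡 n) c.symm (c p)).toLinearMap ?_
    convert h1 using 2 with k
    exact hVeq _ hy k
  have hVcomm : ∀ k l, ∀ y ∈ c.target, VectorField.lieBracket ℝ (V k) (V l) y = 0 := by
    intro k l y hy
    have h1 := VectorField.mpullback_mlieBracket (n := ∞) (I := 𝓡 n) (I' := 𝓡 n)
      (V := Y k) (W := Y l)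
      ((hY k (c.symm y)).mdifferentiableAt (by simp))
      ((hY l (c.symm y)).mdifferentiableAt (by simp)) (hsymm y hy) h2
    have h3 : VectorField.mlieBracket (𝓡 n) (V k) (V l) y = 0 := by
      rw [← h1, VectorField.mpullback_apply, hcomm, map_zero]
    rw [← VectorField.mlieBracketWithin_univ,
      VectorField.mlieBracketWithin_eq_lieBracketWithin] at h3
    exact (congrFun VectorField.lieBracketWithin_univ y).symm.trans h3
  obtain ⟨Φ, hΦp, hΦs, hΦc, hΦc', hΦ⟩ := exists_coordinates_of_commuting_frame c.open_target
    (c.map_source hpc) hV hVli hVcomm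
  refine ⟨c.trans Φ, by simp [hpc, hΦp], ?_, fun k y hy => ?_⟩
  · refine OpenPartialHomeomorph.mem_maximalAtlas_of_contMDiffOn _ ?_ ?_
    · exact hΦc.contMDiffOn.comp
        ((contMDiffOn_of_mem_maximalAtlas hcm).mono fun q hq => hq.1) fun q hq => hq.2
    · exact (contMDiffOn_symm_of_mem_maximalAtlas hcm).comp
        (hΦc'.contMDiffOn.mono fun q hq => hq.1) fun q hq => hq.2
  · have hy1 : y ∈ Φ.target := hy.1
    have hy2 : Φ.symm y ∈ c.target := hy.2
    have h1 : MDifferentiableAt (𝓡 n) (𝓡 n) Φ.symm y :=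
      ((hΦc'.contDiffAt (Φ.open_target.mem_nhds hy1)).differentiableAt
        (by simp)).mdifferentiableAt
    have h2 := mfderiv_comp y (hcd.mdifferentiableAt_symm hy2) h1
    have h3 := DFunLike.congr_fun h2 (EuclideanSpace.single k 1)
    have h4 := hVeq _ hy2 k
    rw [← hΦ y hy1 k, ← mfderiv_eq_fderiv] at h4
    exact h3.trans h4

end Manifold

/-! ### Hessian potentials -/

section Hessian

variable {n : ℕ} {V : Set (EuclideanSpace ℝ (Fin n))}

/-- The Poincaré lemma in components: functions `w i` with `∂w_i/∂xᵏ = ∂w_k/∂xⁱ` on a convex open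
set are the partial derivatives of a function. -/
theorem exists_partialDeriv_eq (hV : IsOpen V) (hconv : Convex ℝ V)
    {w : Fin n → EuclideanSpace ℝ (Fin n) → ℝ} (hw : ∀ i, ContDiffOn ℝ ∞ (w i) V)
    (hsymm : ∀ i k, ∀ y ∈ V, partialDeriv k (w i) y = partialDeriv i (w k) y) :
    ∃ f, ContDiffOn ℝ ∞ f V ∧ ∀ i, ∀ y ∈ V, partialDeriv i f y = w i y := by
  have hη : ContDiffOn ℝ ∞
      (fun y => (frameMap fun i => w i y : EuclideanSpace ℝ (Fin n) →L[ℝ] ℝ)) V :=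
    contDiffOn_clm_of_single fun i => by simpa using hw i
  obtain ⟨f, hf, hfc⟩ := exists_smooth_primitive hV hconv hη fun y hy => clm_symm_of_single
    fun k i => by
      have hd := (hη.contDiffAt (hV.mem_nhds hy)).differentiableAt (by simp)
      have key : ∀ k i, fderiv ℝ
          (fun y => (frameMap fun i => w i y : EuclideanSpace ℝ (Fin n) →L[ℝ] ℝ)) y
          (EuclideanSpace.single k 1) (EuclideanSpace.single i 1) = partialDeriv k (w i) y := by
        intro k i
        have h1 := fderiv_clm_apply hd
          (differentiableAt_const (EuclideanSpace.single i (1 : ℝ) : EuclideanSpace ℝ (Fin n)))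
        have h2 := congrArg (fun L : EuclideanSpace ℝ (Fin n) →L[ℝ] ℝ =>
          L (EuclideanSpace.single k 1)) h1
        simpa [partialDeriv] using h2.symm
      rw [key, key]
      exact hsymm i k y hy
  refine ⟨f, hfc, fun i y hy => ?_⟩
  rw [partialDeriv, (hf y hy).fderiv, frameMap_single]

theorem partialDeriv_congr (hV : IsOpen V) {f g : EuclideanSpace ℝ (Fin n) → ℝ}
    (h : ∀ y ∈ V, f y = g y) (k : Fin n) {y : EuclideanSpace ℝ (Fin n)} (hy : y ∈ V) :
    partialDeriv k f y = partialDeriv k g y := by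
  have : f =ᶠ[𝓝 y] g := by
    filter_upwards [hV.mem_nhds hy] with z hz using h z hz
  rw [partialDeriv, partialDeriv, this.fderiv_eq]

/-- A symmetric matrix of functions on a convex open set whose partial derivatives are totally
symmetric is a Hessian. -/
theorem exists_isHessianPotential (hV : IsOpen V) (hconv : Convex ℝ V)
    {b : Fin n → Fin n → EuclideanSpace ℝ (Fin n) → ℝ} (hb : ∀ i j, ContDiffOn ℝ ∞ (b i j) V)
    (hsymm : ∀ i j, ∀ y ∈ V, b i j y = b j i y)
    (hderiv : ∀ i j k, ∀ y ∈ V, partialDeriv k (b i j) y = partialDeriv i (b k j) y) :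
    ∃ F, IsHessianPotential F V b := by
  -- For fixed `j`, `hderiv` says that `∑ b_ij dxⁱ` is closed, with primitive `g j`; then `hsymm`
  -- says that `∑ g_j dxʲ` is closed, with primitive `F`.
  choose g hg hgb using fun j => exists_partialDeriv_eq hV hconv (w := fun i => b i j)
    (fun i => hb i j) fun i k y hy => hderiv i j k y hy
  obtain ⟨F, hF, hFg⟩ := exists_partialDeriv_eq hV hconv hg fun i k y hy => by
    rw [hgb i k y hy, hgb k i y hy, hsymm k i y hy]
  refine ⟨F, hF, fun i j y hy => ?_⟩
  rw [hessian, Matrix.of_apply, partialDeriv_congr hV (hFg j) i hy, hgb j i y hy]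

theorem IsHessianPotential.hessianDeriv_apply (hV : IsOpen V)
    {b : Fin n → Fin n → EuclideanSpace ℝ (Fin n) → ℝ} {F : EuclideanSpace ℝ (Fin n) → ℝ}
    (hF : IsHessianPotential F V b) (i j k : Fin n) {y : EuclideanSpace ℝ (Fin n)} (hy : y ∈ V) :
    hessianDeriv F k y i j = partialDeriv k (b i j) y :=
  partialDeriv_congr hV (fun z hz => (hF.2 i j z hz).symm) k hy

end Hessian

/-- The differential `da_ij = θ_ij` is evaluated on `∂/∂xᵏ = R_k X`. -/
theorem IsPotentialFamily.partialDeriv_eq {n : ℕ} {M : Type*} [TopologicalSpace M]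
    [ChartedSpace (EuclideanSpace ℝ (Fin n)) M] {R : Fin n → Tensor11 n M} {X : VField n M}
    {θ : OneForm n M} {e : OpenPartialHomeomorph M (EuclideanSpace ℝ (Fin n))}
    (he : IsCoordinateSystemFor e fun k => applyField (R k) X)
    {a : Fin n → Fin n → M → ℝ} (ha : IsPotentialFamily R θ e.source a) (i j k : Fin n)
    {y : EuclideanSpace ℝ (Fin n)} (hy : y ∈ e.target) :
    partialDeriv k (fun z => a i j (e.symm z)) y = cFun R X θ i j k (e.symm y) := by
  rw [partialDeriv, (hasFDerivAt_of_hasMFDerivAt he.mem_atlas hy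
    (ha.deriv_eq i j _ (e.map_target hy))).fderiv]
  exact he.localForm_single hy k

/-! ### Magri–Lenard complexes -/

section Complex

variable {n : ℕ} [NeZero n] {M : Type*} [TopologicalSpace M]
  [ChartedSpace (EuclideanSpace ℝ (Fin n)) M] [IsManifold (𝓡 n) ∞ M]
  {R : Fin n → Tensor11 n M} {X : VField n M} {θ : OneForm n M}

namespace IsMagriLenardComplex

theorem commute_apply (h : IsMagriLenardComplex R X θ) (k l : Fin n) (q : M)
    (v : TangentSpace (𝓡 n) q) : R k q (R l q v) = R l q (R k q v) :=
  DFunLike.congr_fun (h.R_commute k l q) v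

theorem cFun_swap_left (h : IsMagriLenardComplex R X θ) (i j k : Fin n) (q : M) :
    cFun R X θ i j k q = cFun R X θ j i k q :=
  congrArg (θ q) (h.commute_apply i j q _)

theorem cFun_swap_right (h : IsMagriLenardComplex R X θ) (i j k : Fin n) (q : M) :
    cFun R X θ i j k q = cFun R X θ i k j q :=
  congrArg (fun v => θ q (R i q v)) (h.commute_apply j k q _)

theorem smooth_field (h : IsMagriLenardComplex R X θ) (k : Fin n) :
    SmoothVField (applyField (R k) X) :=
  h.smooth_X.applyField (h.smooth_R k)

/-- These are the components of `θ_ij` along the coordinate fields; their smoothness yields smooth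
potentials and a continuous determinant of `(c_ij1)`. -/
theorem contMDiff_cFun (h : IsMagriLenardComplex R X θ) (i j k : Fin n) :
    ContMDiff (𝓡 n) 𝓘(ℝ, ℝ) ∞ (cFun R X θ i j k) :=
  h.smooth_θ.apply
    (((h.smooth_field k).applyField (h.smooth_R j)).applyField (h.smooth_R i))

variable {e : OpenPartialHomeomorph M (EuclideanSpace ℝ (Fin n))}

/-- The forms `θ R_j` are independent exactly where the matrix `c_ij1` is invertible. -/
theorem isUnit_cFun_iff (h : IsMagriLenardComplex R X θ)
    (he : IsCoordinateSystemFor e fun k => applyField (R k) X)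
    {y : EuclideanSpace ℝ (Fin n)} (hy : y ∈ e.target) :
    IsUnit (Matrix.of fun i j => cFun R X θ i j 0 (e.symm y)) ↔
      LinearIndependent ℝ (fun j => formComp θ (R 0) (R j) (e.symm y)) := by
  obtain ⟨b, hb⟩ := he.exists_basis hy
  rw [← isUnit_matrix_covectors_iff b]
  have : (Matrix.of fun i j => cFun R X θ i j 0 (e.symm y)) =
      Matrix.of fun i j => formComp θ (R 0) (R j) (e.symm y) (b i) := by
    ext i j
    rw [Matrix.of_apply, Matrix.of_apply, hb, h.cFun_swap_left, h.cFun_swap_right,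
      h.cFun_swap_left]
    rfl
  rw [this]

/-- Coordinates with `∂/∂xᵏ = R_k X`, on a convex domain on which the forms `θ R_j` stay
independent. -/
theorem exists_coordinates (h : IsMagriLenardComplex R X θ) {p : M}
    (hX : LinearIndependent ℝ fun k => applyField (R k) X p) :
    ∃ e : OpenPartialHomeomorph M (EuclideanSpace ℝ (Fin n)), p ∈ e.source ∧
      IsCoordinateSystemFor e (fun k => applyField (R k) X) ∧ Convex ℝ e.target ∧
      (LinearIndependent ℝ (fun j => formComp θ (R 0) (R j) p) → ∀ q ∈ e.source,
        LinearIndependent ℝ (fun j => formComp θ (R 0) (R j) q)) := by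
  obtain ⟨e, hp, he⟩ := exists_isCoordinateSystemFor h.smooth_field h.fields_commute hX
  have hiff : ∀ q ∈ e.source, IsUnit (Matrix.of fun i j => cFun R X θ i j 0 q) ↔
      LinearIndependent ℝ (fun j => formComp θ (R 0) (R j) q) := by
    intro q hq
    have h1 := h.isUnit_cFun_iff he (e.map_source hq)
    rwa [e.left_inv hq] at h1
  -- Independence at `p` is the nonvanishing of a continuous determinant, hence persists nearby;
  -- otherwise the implication is vacuous and only convexity is needed.
  by_cases hli : LinearIndependent ℝ (fun j => formComp θ (R 0) (R j) p)
  · have hcont : Continuous fun q => (Matrix.of fun i j => cFun R X θ i j 0 q).det :=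
      Continuous.matrix_det (continuous_matrix fun i j => (h.contMDiff_cFun i j 0).continuous)
    have hdet : (Matrix.of fun i j => cFun R X θ i j 0 p).det ≠ 0 := by
      rw [← isUnit_iff_ne_zero, ← Matrix.isUnit_iff_isUnit_det]
      exact (hiff p hp).2 hli
    obtain ⟨e', hp', he', hsub, hconv⟩ := he.exists_convex_restriction hp
      (inter_mem (e.open_source.mem_nhds hp) (hcont.continuousAt.eventually_ne hdet))
    refine ⟨e', hp', he', hconv, fun _ q hq => (hiff q (hsub hq).1).1 ?_⟩
    rw [Matrix.isUnit_iff_isUnit_det, isUnit_iff_ne_zero]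
    exact (hsub hq).2
  · obtain ⟨e', hp', he', -, hconv⟩ := he.exists_convex_restriction hp univ_mem
    exact ⟨e', hp', he', hconv, fun hli' => absurd hli' hli⟩

theorem exists_isPotentialFamily (h : IsMagriLenardComplex R X θ)
    (he : IsCoordinateSystemFor e fun k => applyField (R k) X) (hconv : Convex ℝ e.target) :
    ∃ a, IsPotentialFamily R θ e.source a := by
  -- Potentials are chosen per form rather than per index pair, so `θ_ij = θ_ji` forces `a_ij =
  -- a_ji` with no constants of integration to adjust.
  have hex : ∀ η : OneForm n M, (∃ i j, η = formComp θ (R i) (R j)) →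
      ∃ f : M → ℝ, ContMDiffOn (𝓡 n) 𝓘(ℝ, ℝ) ∞ f e.source ∧
        ∀ q ∈ e.source, HasMFDerivAt (𝓡 n) 𝓘(ℝ, ℝ) f q (η q) := by
    rintro _ ⟨i, j, rfl⟩
    exact he.exists_potential hconv (fun k => h.contMDiff_cFun i j k) (h.forms_closed i j)
  choose! f hf hf' using hex
  refine ⟨fun i j => f (formComp θ (R i) (R j)), fun i j => hf _ ⟨i, j, rfl⟩,
    fun i j q _ => ?_, fun i j => hf' _ ⟨i, j, rfl⟩⟩
  have : formComp θ (R i) (R j) = formComp θ (R j) (R i) :=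
    funext fun q => congrArg (θ q).comp (h.R_commute i j q)
  rw [this]

end IsMagriLenardComplex

end Complex

end MagriLenard

/-! ### The main theorem -/

theorem mainTheorem6 {n : ℕ} [NeZero n] {M : Type*} [TopologicalSpace M]
    [ChartedSpace (EuclideanSpace ℝ (Fin n)) M] [IsManifold (𝓡 n) ∞ M]
    (R : Fin n → Tensor11 n M) (X : VField n M) (θ : OneForm n M)
    (hML : IsMagriLenardComplex R X θ)
    (p : M) (hX : LinearIndependent ℝ (fun k => applyField (R k) X p)) :
    -- `c_ijk` is symmetric in its three indices and equals `⟨θ R_i R_j, R_k X⟩`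
    (∀ i j k q, cFun R X θ i j k q = formComp θ (R i) (R j) q (applyField (R k) X q) ∧
      cFun R X θ i j k q = cFun R X θ j i k q ∧ cFun R X θ i j k q = cFun R X θ i k j q) ∧
    -- coordinates around `p` with `∂/∂xᵏ = R_k X`
    ∃ e : OpenPartialHomeomorph M (EuclideanSpace ℝ (Fin n)), p ∈ e.source ∧
      IsCoordinateSystemFor e (fun k => applyField (R k) X) ∧
      -- if the forms `θ R_j` are independent at `p`, the domain is so small that they stay so
      (LinearIndependent ℝ (fun j => formComp θ (R 0) (R j) p) → ∀ q ∈ e.source,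
        LinearIndependent ℝ (fun j => formComp θ (R 0) (R j) q)) ∧
      (∃ a : Fin n → Fin n → M → ℝ, IsPotentialFamily R θ e.source a) ∧
      ∀ a : Fin n → Fin n → M → ℝ, IsPotentialFamily R θ e.source a →
        -- `c_ijk = ∂a_ij/∂xᵏ`
        (∀ i j k, ∀ y ∈ e.target,
          cFun R X θ i j k (e.symm y) = partialDeriv k (fun z => a i j (e.symm z)) y) ∧
        -- `a_ij = ∂²F/∂xⁱ∂xʲ` for some `F`
        (∃ F : EuclideanSpace ℝ (Fin n) → ℝ,
          IsHessianPotential F e.target (fun i j z => a i j (e.symm z))) ∧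
        -- every such `F` satisfies WDVV wherever `∂h/∂x¹` is invertible, i.e. wherever the
        -- `1`-forms `θ R_j` are independent
        ∀ F : EuclideanSpace ℝ (Fin n) → ℝ,
          IsHessianPotential F e.target (fun i j z => a i j (e.symm z)) →
          ∀ y ∈ e.target,
            (IsUnit (hessianDeriv F 0 y) ↔
              LinearIndependent ℝ (fun j => formComp θ (R 0) (R j) (e.symm y))) ∧
            (IsUnit (hessianDeriv F 0 y) → SatisfiesWDVVAt F y) := by
  have hc : ∀ i j k q, cFun R X θ i j k q = formComp θ (R i) (R j) q (applyField (R k) X q) ∧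
      cFun R X θ i j k q = cFun R X θ j i k q ∧ cFun R X θ i j k q = cFun R X θ i k j q :=
    fun i j k q => ⟨rfl, hML.cFun_swap_left i j k q, hML.cFun_swap_right i j k q⟩
  obtain ⟨e, hp, he, hconv, hli⟩ := hML.exists_coordinates hX
  refine ⟨hc, e, hp, he, hli, hML.exists_isPotentialFamily he hconv, fun a ha => ?_⟩
  have hd : ∀ i j k, ∀ y ∈ e.target,
      partialDeriv k (fun z => a i j (e.symm z)) y = cFun R X θ i j k (e.symm y) :=
    fun i j k y hy => ha.partialDeriv_eq he i j k hy
  refine ⟨fun i j k y hy => (hd i j k y hy).symm, ?_, fun F hF y hy => ?_⟩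
  · refine exists_isHessianPotential e.open_target hconv (fun i j => ?_)
      (fun i j y hy => ha.symm i j _ (e.map_target hy)) fun i j k y hy => ?_
    · exact ((ha.smooth i j).comp (contMDiffOn_symm_of_mem_maximalAtlas he.mem_atlas)
        fun y hy => e.map_target hy).contDiffOn
    · rw [hd i j k y hy, hd k j i y hy, hML.cFun_swap_left, hML.cFun_swap_right,
        hML.cFun_swap_left]
  · have hH : ∀ k, hessianDeriv F k y = Matrix.of fun i j => cFun R X θ i j k (e.symm y) := by
      intro k
      ext i j
      rw [hF.hessianDeriv_apply e.open_target i j k hy, hd i j k y hy, Matrix.of_apply]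
    refine ⟨by rw [hH, hML.isUnit_cFun_iff he hy], fun hu => ⟨hu, fun i j => ?_⟩⟩
    obtain ⟨b, hb⟩ := he.exists_basis hy
    refine wdvv_of_commute (θ (e.symm y)) (fun k => R k (e.symm y)) (X (e.symm y))
      (fun k l => hML.R_commute k l _) b hb ?_ hu hH i j
    -- Here `R 0 = Id` enters: it identifies `c_ij0` with `⟨θ, R_i R_j X⟩`.
    rw [hH]
    ext i j
    simp [cFun, hML.R_one]
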